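/- A dipole $D=(\mathbf s_D,\mathbf e_D)$ is an ordered pair of distinct points of $\mathbb R^2$ (start point and end point); let $\mathbb D$ be the set of all dipoles. A point $p$ is in exactly one of seven positions relative to $D$: to the left ($\mathrm l$) or to the right ($\mathrm r$) of the oriented line through $D$, or on this line and straight behind $\mathbf s_D$ ($\mathrm b$), equal to $\mathbf s_D$ ($\mathrm s$), strictly inside the segment ($\mathrm i$), equal to $\mathbf e_D$ ($\mathrm e$), or straight in front of $\mathbf e_D$ ($\mathrm f$). For $A,B\in\mathbb D$ the word $R_1R_2R_3R_4$ holds if $\mathbf s_B$, $\mathbf e_B$ are in the positions $R_1,R_2$ relative to $A$, and $\mathbf s_A,\mathbf e_A$ are in the positions $R_3,R_4$ relative to $B$. Exactly 72 such words are geometrically possible. The qualitative angle from $A$ to $B$ is $+$ (resp. $-$) if $\det(\mathbf e_A-\mathbf s_A,\ \mathbf e_B-\mathbf s_B)$ is positive (resp. negative), and $P$ (resp. $A$) if the direction vectors are parallel with the same (resp. opposite) orientation. The 80 base relations of $\mathcal{DRA}_{fp}$ are the 68 possible words other than $\mathrm{llll},\mathrm{llrr},\mathrm{rrll},\mathrm{rrrr}$,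 together with the twelve refinements $\mathrm{llll}+,\mathrm{llll}-,\mathrm{llll}A$, $\mathrm{rrrr}+,\mathrm{rrrr}-,\mathrm{rrrr}A$, $\mathrm{llrr}+,\mathrm{llrr}-,\mathrm{llrr}P$, $\mathrm{rrll}+,\mathrm{rrll}-,\mathrm{rrll}P$ of these four by the qualitative angle from $A$ to $B$. Let $R_b\subseteq\mathbb D\times\mathbb D$ be the extension of a base relation $b$, and put $R_S=\bigcup_{b\in S}R_b$ for a set $S$ of base relations. The weak composition of base relations is $$b_1;b_2=\{b \mid (R_{b_1}\circ R_{b_2})\cap R_b\neq\emptyset\},\qquad R_{b_1}\circ R_{b_2}=\{(A,C)\mid \exists B\in\mathbb D:\ (A,B)\in R_{b_1},\ (B,C)\in R_{b_2}\}.$$ Theorem. Composition in $\mathcal{DRA}_{fp}$ is strong: for all base relations $r_{ab},r_{bc}$ of $\mathcal{DRA}_{fp}$, $$R_{r_{ab};r_{bc}}=R_{r_{ab}}\circ R_{r_{bc}}.$$ In particular, whenever $r_{ac}\in r_{ab};r_{bc}$ and $A,C$ are dipoles with $A\,r_{ac}\,C$, there is a dipole $B$ with $A\,r_{ab}\,B$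 and $B\,r_{bc}\,C$. -/

import Mathlib

/-- The Euclidean plane in Cartesian coordinates. -/
abbrev Plane : Type := ℝ × ℝ

/-- A dipole: an ordered pair of distinct points of the plane (start point, end point). -/
structure Dipole where
  st : Plane
  ed : Plane
  st_ne_ed : st ≠ ed

/-- The direction vector of a dipole. -/
def Dipole.dir (A : Dipole) : Plane := A.ed - A.st

/-- `det u v > 0` iff the angle from `u` to `v` lies strictly between `0` and `π`. -/
def det (u v : Plane) : ℝ := u.1 * v.2 - u.2 * v.1

/-- The Euclidean scalar product. -/
def dot (u v : Plane) : ℝ := u.1 * v.1 + u.2 * v.2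

/-- The seven dipole-point relations: left, right, straight behind, at the start point, inside,
at the end point, straight in front. -/
inductive LR where
  | l | r | b | s | i | e | f
  deriving DecidableEq

/-- `x.Holds A p`: the point `p` is in the dipole-point relation `x` to the dipole `A`. -/
def LR.Holds : LR → Dipole → Plane → Prop
  | .l, A, p => 0 < det A.dir (p - A.st)
  | .r, A, p => det A.dir (p - A.st) < 0
  | .b, A, p => Sbtw ℝ p A.st A.ed
  | .s, A, p => p = A.st
  | .i, A, p => Sbtw ℝ A.st p A.ed
  | .e, A, p => p = A.ed
  | .f, A, p => Sbtw ℝ A.st A.ed p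

/-- The four qualitative angles between two dipoles: positive, negative, parallel,
anti-parallel. -/
inductive QAngle where
  | pos | neg | par | anti
  deriving DecidableEq

/-- `q.Holds A B`: the qualitative angle from the dipole `A` to the dipole `B` is `q`. -/
def QAngle.Holds : QAngle → Dipole → Dipole → Prop
  | .pos, A, B => 0 < det A.dir B.dir
  | .neg, A, B => det A.dir B.dir < 0
  | .par, A, B => det A.dir B.dir = 0 ∧ 0 < dot A.dir B.dir
  | .anti, A, B => det A.dir B.dir = 0 ∧ dot A.dir B.dir < 0

/-- Relation symbols: a word of four dipole-point letters, optionally followed by a qualitative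
angle. -/
structure RelSymbol where
  r₁ : LR
  r₂ : LR
  r₃ : LR
  r₄ : LR
  angle : Option QAngle
  deriving DecidableEq

/-- The relation between dipoles that a symbol denotes. A symbol without a qualitative angle
puts no condition on the angle. -/
def RelSymbol.ext (x : RelSymbol) : SetRel Dipole Dipole :=
  {(A, B) | x.r₁.Holds A B.st ∧ x.r₂.Holds A B.ed ∧ x.r₃.Holds B A.st ∧ x.r₄.Holds B A.ed ∧
    ∀ q ∈ x.angle, q.Holds A B}

/-- The base relations of `DRA_fp`: the four words `llll`, `llrr`, `rrll`, `rrrr` are refined by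
the qualitative angle, the 68 other geometrically possible words are not. -/
def baseSymbols : Finset RelSymbol := [
   ⟨.l, .l, .l, .l, some .pos⟩, ⟨.l, .l, .l, .l, some .neg⟩, ⟨.l, .l, .l, .l, some .anti⟩,
   ⟨.l, .l, .r, .r, some .pos⟩, ⟨.l, .l, .r, .r, some .neg⟩, ⟨.l, .l, .r, .r, some .par⟩,
   ⟨.r, .r, .l, .l, some .pos⟩, ⟨.r, .r, .l, .l, some .neg⟩, ⟨.r, .r, .l, .l, some .par⟩,
   ⟨.r, .r, .r, .r, some .pos⟩, ⟨.r, .r, .r, .r, some .neg⟩, ⟨.r, .r, .r, .r, some .anti⟩,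
   ⟨.b, .b, .b, .b, none⟩, ⟨.b, .b, .f, .f, none⟩, ⟨.b, .e, .i, .e, none⟩,
   ⟨.b, .f, .i, .i, none⟩, ⟨.b, .i, .i, .f, none⟩, ⟨.b, .l, .r, .r, none⟩,
   ⟨.b, .r, .l, .l, none⟩, ⟨.b, .s, .e, .f, none⟩, ⟨.e, .b, .i, .s, none⟩,
   ⟨.e, .f, .b, .s, none⟩, ⟨.e, .i, .f, .s, none⟩, ⟨.e, .l, .l, .s, none⟩,
   ⟨.e, .r, .r, .s, none⟩, ⟨.e, .s, .e, .s, none⟩, ⟨.f, .b, .i, .i, none⟩,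
   ⟨.f, .e, .f, .e, none⟩, ⟨.f, .f, .b, .b, none⟩, ⟨.f, .f, .f, .f, none⟩,
   ⟨.f, .i, .f, .i, none⟩, ⟨.f, .l, .l, .l, none⟩, ⟨.f, .r, .r, .r, none⟩,
   ⟨.f, .s, .e, .i, none⟩, ⟨.i, .b, .i, .b, none⟩, ⟨.i, .e, .b, .e, none⟩,
   ⟨.i, .f, .b, .i, none⟩, ⟨.i, .i, .b, .f, none⟩, ⟨.i, .i, .f, .b, none⟩,
   ⟨.i, .l, .l, .r, none⟩, ⟨.i, .r, .r, .l, none⟩, ⟨.i, .s, .e, .b, none⟩,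
   ⟨.l, .b, .l, .l, none⟩, ⟨.l, .e, .r, .e, none⟩, ⟨.l, .f, .r, .r, none⟩,
   ⟨.l, .i, .r, .l, none⟩, ⟨.l, .l, .b, .r, none⟩, ⟨.l, .l, .f, .l, none⟩,
   ⟨.l, .l, .l, .b, none⟩, ⟨.l, .l, .l, .r, none⟩, ⟨.l, .l, .r, .f, none⟩,
   ⟨.l, .l, .r, .l, none⟩, ⟨.l, .r, .i, .l, none⟩, ⟨.l, .r, .l, .l, none⟩,
   ⟨.l, .r, .r, .i, none⟩, ⟨.l, .r, .r, .l, none⟩, ⟨.l, .r, .r, .r, none⟩,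
   ⟨.l, .s, .e, .l, none⟩, ⟨.r, .b, .r, .r, none⟩, ⟨.r, .e, .l, .e, none⟩,
   ⟨.r, .f, .l, .l, none⟩, ⟨.r, .i, .l, .r, none⟩, ⟨.r, .l, .i, .r, none⟩,
   ⟨.r, .l, .l, .i, none⟩, ⟨.r, .l, .l, .l, none⟩, ⟨.r, .l, .l, .r, none⟩,
   ⟨.r, .l, .r, .r, none⟩, ⟨.r, .r, .b, .l, none⟩, ⟨.r, .r, .f, .r, none⟩,
   ⟨.r, .r, .l, .f, none⟩, ⟨.r, .r, .l, .r, none⟩, ⟨.r, .r, .r, .b, none⟩,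
   ⟨.r, .r, .r, .l, none⟩, ⟨.r, .s, .e, .r, none⟩, ⟨.s, .b, .s, .b, none⟩,
   ⟨.s, .e, .s, .e, none⟩, ⟨.s, .f, .s, .i, none⟩, ⟨.s, .i, .s, .f, none⟩,
   ⟨.s, .l, .s, .r, none⟩, ⟨.s, .r, .s, .l, none⟩].toFinset

theorem card_baseSymbols : baseSymbols.card = 80 := by
  decide +kernel

/-- The type of (names of) base relations of `DRA_fp`. -/
abbrev DRAfp : Type := {x : RelSymbol // x ∈ baseSymbols}

namespace DRAfp

/-- The set-theoretic extension of a base relation. -/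
def ext (x : DRAfp) : SetRel Dipole Dipole := x.1.ext

/-- The extension of a general relation, that is, of a set of base relations. -/
def extSet (S : Set DRAfp) : SetRel Dipole Dipole := ⋃ x ∈ S, ext x

/-- Weak composition `x ; y` of base relations: all base relations that meet the set-theoretic
composition of the extensions. -/
def weakComp (x y : DRAfp) : Set DRAfp :=
  {z | (SetRel.comp (ext x) (ext y) ∩ ext z).Nonempty}

end DRAfp

/-! The inclusion of the composition in the weak composition only needs that every pair of dipoles
lies in some base relation (`exists_mem_ext`). The other inclusion is a transfer statement
(`transfers_of_mem_ext`): if `(A, C)` and `(A', C')` lie in the same base relation, then every `B`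
has a counterpart `B'` that is related to `A'` and `C'` as `B` is to `A` and `C`.

No affine map need carry one pair to the other, since a base relation fixes only signs. If the lines
of `A` and `C` cross, these are the orientation of the crossing and the position of the crossing
point relative to `0, 1` along each dipole (`Crosses.sign_eq_of_mem_ext`). If the lines are
parallel, they are the side, the relative orientation and, on a common line, the order of the four
end points (`ParallelAt.sign_eq_of_mem_ext`). The qualitative angle enters exactly for the words
whose letters leave the angle open (`sign_det_eq_of_mem_ext`).

In turn, these signs determine the relation (`Crosses.sameRel`, `ParallelAt.sameRel`). So `B'` is
built by moving the points where `B` meets the lines of `A` and `C`: finite order isomorphisms of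
the real line (`SameOrder.exists_cons`) move each point on its line, and the line through the new
points is given the parameters that `B` had. The cases are `transfers_of_crosses` and
`transfers_of_parallelAt`. -/

open SignType (sign)

/-! ### Signs -/

theorem sign_div_eq_mul (a b : ℝ) : sign (a / b) = sign a * sign b := by
  rcases lt_trichotomy b 0 with hb | rfl | hb
  · rw [div_eq_mul_inv, sign_mul, sign_neg hb, sign_neg (inv_lt_zero.2 hb)]
  · simp
  · rw [div_eq_mul_inv, sign_mul, sign_pos hb, sign_pos (inv_pos.2 hb)]

theorem sign_sub_comm (a b : ℝ) : sign (a - b) = -sign (b - a) := by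
  rw [← neg_sub, Left.sign_neg]

/-- Numbers of different sign are ordered as their signs are. Applied to the sides of the two end
points of a dipole, this yields the sign of the angle. -/
theorem sign_sub_eq_of_sign_ne {a b a' b' : ℝ} (ha : sign a = sign a') (hb : sign b = sign b')
    (hab : sign a ≠ sign b) : sign (a - b) = sign (a' - b') := by
  have pos {x y : ℝ} (h : sign x = sign y) : 0 < x ↔ 0 < y := by
    rw [← sign_eq_one_iff, h, sign_eq_one_iff]
  have neg {x y : ℝ} (h : sign x = sign y) : x < 0 ↔ y < 0 := by
    rw [← sign_eq_neg_one_iff, h, sign_eq_neg_one_iff]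
  have ha₁ := pos ha
  have ha₂ := neg ha
  have hb₁ := pos hb
  have hb₂ := neg hb
  have hlt : a < b ∨ b < a := lt_or_gt_of_ne fun h => hab (by rw [h])
  rcases hlt with h | h
  · have : a < 0 ∧ 0 ≤ b ∨ a ≤ 0 ∧ 0 < b := by
      by_contra! k
      rcases lt_trichotomy a 0 with l | rfl | l
      · exact hab (by rw [sign_neg l, sign_neg (by grind)])
      · grind
      · exact hab (by rw [sign_pos l, sign_pos (by grind)])
    rw [sign_neg (by linarith), sign_neg (by grind)]
  · have : a ≤ 0 → b < 0 ∧ a = 0 := by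
      intro k
      rcases k.lt_or_eq with l | rfl
      · exact absurd (by rw [sign_neg l, sign_neg (by grind)]) hab
      · exact ⟨h, rfl⟩
    have : 0 < a → b ≤ 0 := by
      intro k
      by_contra! l
      exact hab (by rw [sign_pos k, sign_pos l])
    rw [sign_pos (by linarith), sign_pos (by grind)]

theorem cmp_eq_cmp_iff_sign_sub {a b c d : ℝ} :
    cmp a b = cmp c d ↔ sign (a - b) = sign (c - d) := by
  rcases lt_trichotomy a b with h | rfl | h <;> rcases lt_trichotomy c d with k | rfl | k <;>
    simp_all [cmp, cmpUsing, sign_neg, sign_pos, not_lt_of_gt]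

theorem SignType.eq_of_mul_eq_mul {a b a' b' : SignType} (h : a * b = a' * b') (hb : b = b')
    (hb0 : b ≠ 0) : a = a' := by
  revert a b a' b'; decide

/-! ### Finite order isomorphisms of the line -/

/-- Two tuples of reals have the same order type. -/
def SameOrder {n : ℕ} (v v' : Fin n → ℝ) : Prop :=
  ∀ i j, sign (v i - v j) = sign (v' i - v' j)

/-- One step of Cantor's back-and-forth: the reals are dense and without end points, so a finite
order isomorphism extends to one more point. -/
theorem SameOrder.exists_cons {n : ℕ} {v v' : Fin n → ℝ} (h : SameOrder v v') (x : ℝ) :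
    ∃ x', SameOrder (Matrix.vecCons x v) (Matrix.vecCons x' v') := by
  obtain ⟨x', hx'⟩ := Order.PartialIso.exists_across (α := ℝ) (β := ℝ)
    ⟨Finset.univ.image fun i => (v i, v' i), by
      intro p hp q hq
      obtain ⟨i, -, rfl⟩ := Finset.mem_image.1 hp
      obtain ⟨j, -, rfl⟩ := Finset.mem_image.1 hq
      exact cmp_eq_cmp_iff_sign_sub.2 (h i j)⟩ x
  have key (i : Fin n) : sign (v i - x) = sign (v' i - x') :=
    cmp_eq_cmp_iff_sign_sub.1
      (hx' (v i, v' i) (Finset.mem_image_of_mem (fun i => (v i, v' i)) (Finset.mem_univ i)))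
  refine ⟨x', fun i j => ?_⟩
  refine Fin.cases ?_ (fun i => ?_) i <;> refine Fin.cases ?_ (fun j => ?_) j
  · simp
  · simpa [sign_sub_comm x, sign_sub_comm x'] using key j
  · simpa using key i
  · simpa using h i j

theorem sameOrder_zero_one_cons {a a' : ℝ} (h₀ : sign a = sign a')
    (h₁ : sign (a - 1) = sign (a' - 1)) : SameOrder ![a, 0, 1] ![a', 0, 1] := by
  intro i j
  fin_cases i <;> fin_cases j <;> simp [h₀, h₁, Left.sign_neg, sign_sub_comm 1]

theorem sameOrder_pair {a b a' b' : ℝ} (h : sign (a - b) = sign (a' - b')) :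
    SameOrder ![a, b] ![a', b'] := by
  intro i j
  fin_cases i <;> fin_cases j <;> simp [h, sign_sub_comm b, sign_sub_comm b']

theorem sameOrder_zero_one_pair {a b a' b' : ℝ} (h : sign (b - a) = sign (b' - a'))
    (ha₀ : sign a = sign a') (ha₁ : sign (a - 1) = sign (a' - 1))
    (hb₀ : sign b = sign b') (hb₁ : sign (b - 1) = sign (b' - 1)) :
    SameOrder ![a, b, 0, 1] ![a', b', 0, 1] := by
  intro i j
  fin_cases i <;> fin_cases j <;>
    simp [h, ha₀, ha₁, hb₀, hb₁, Left.sign_neg, sign_sub_comm 1, sign_sub_comm a b,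
      sign_sub_comm a' b']

/-! ### Dipole-point relations in terms of signs -/

/-- The dipole-point relation of a point with affine coordinates `t` along the dipole and `z`
across it, given the side `σ` of the point and the signs `τ₀` of `t` and `τ₁` of `t - 1`. -/
def LR.ofSigns : SignType → SignType → SignType → LR
  | .pos, _, _ => .l
  | .neg, _, _ => .r
  | .zero, .neg, _ => .b
  | .zero, .zero, _ => .s
  | .zero, .pos, .neg => .i
  | .zero, .pos, .zero => .e
  | .zero, .pos, .pos => .f

/-- The side of the oriented line on which a dipole-point relation takes place. -/
def LR.side : LR → SignType
  | .l => 1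
  | .r => -1
  | _ => 0

theorem LR.side_ofSigns (σ τ₀ τ₁ : SignType) : (LR.ofSigns σ τ₀ τ₁).side = σ := by
  revert σ τ₀ τ₁; decide

/-- The possible pairs of signs of `t` and `t - 1`. -/
def SignType.UnitCompatible (τ₀ τ₁ : SignType) : Prop := τ₀ ≠ 1 → τ₁ = -1

instance (τ₀ τ₁ : SignType) : Decidable (SignType.UnitCompatible τ₀ τ₁) :=
  inferInstanceAs (Decidable (_ → _))

theorem unitCompatible_sign (t : ℝ) : SignType.UnitCompatible (sign t) (sign (t - 1)) := by
  intro h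
  rw [ne_eq, sign_eq_one_iff] at h
  exact sign_neg (by linarith)

theorem LR.ofSigns_inj {a b a' b' : SignType} (h : SignType.UnitCompatible a b)
    (h' : SignType.UnitCompatible a' b') (e : LR.ofSigns 0 a b = LR.ofSigns 0 a' b') :
    a = a' ∧ b = b' := by
  revert a b a' b'; decide

theorem Dipole.dir_ne_zero (A : Dipole) : A.dir ≠ 0 := sub_ne_zero.2 A.st_ne_ed.symm

theorem Dipole.ed_eq (A : Dipole) : A.ed = A.st + A.dir := by simp [Dipole.dir]

theorem det_swap (u v : Plane) : det v u = -det u v := by simp only [det]; ring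

theorem dot_comm (u v : Plane) : dot u v = dot v u := by simp only [dot]; ring

/-- The vector `u` turned by a right angle. -/
def rot (u : Plane) : Plane := (-u.2, u.1)

theorem dot_self_pos {u : Plane} (hu : u ≠ 0) : 0 < dot u u := by
  have : u.1 ≠ 0 ∨ u.2 ≠ 0 := by
    by_contra! h
    exact hu (Prod.ext h.1 h.2)
  simp only [dot]
  rcases this with h | h <;> nlinarith [mul_self_pos.2 h, mul_self_nonneg u.1, mul_self_nonneg u.2]

theorem det_rot (u v : Plane) : det u (rot v) = dot u v := by simp only [det, rot, dot]; ring

theorem smul_add_smul_eq_iff {u w : Plane} (h : det u w ≠ 0) {t z r : ℝ} :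
    t • u + z • w = r • u ↔ z = 0 ∧ t = r := by
  constructor
  · intro e
    have e₁ := congrArg Prod.fst e
    have e₂ := congrArg Prod.snd e
    simp only [Prod.fst_add, Prod.snd_add, Prod.smul_fst, Prod.smul_snd, smul_eq_mul] at e₁ e₂
    have hz : z * det u w = 0 := by simp only [det]; linear_combination u.1 * e₂ - u.2 * e₁
    have ht : (t - r) * det u w = 0 := by simp only [det]; linear_combination w.2 * e₁ - w.1 * e₂
    exact ⟨(mul_eq_zero.1 hz).resolve_right h, sub_eq_zero.1 ((mul_eq_zero.1 ht).resolve_right h)⟩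
  · rintro ⟨rfl, rfl⟩
    simp

theorem LR.holds_iff {A : Dipole} {p w : Plane} {t z : ℝ} (hw : det A.dir w ≠ 0)
    (hp : p = A.st + t • A.dir + z • w) (x : LR) :
    x.Holds A p ↔ x = LR.ofSigns (sign z * sign (det A.dir w)) (sign t) (sign (t - 1)) := by
  have hdet : det A.dir (p - A.st) = z * det A.dir w := by
    subst hp
    simp only [det, Prod.fst_sub, Prod.snd_sub, Prod.fst_add, Prod.snd_add, Prod.smul_fst,
      Prod.smul_snd, smul_eq_mul]
    ring
  have hline (r : ℝ) : p = A.st + r • A.dir ↔ z = 0 ∧ t = r := by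
    rw [← smul_add_smul_eq_iff hw, hp, add_assoc, add_right_inj]
  have hs : p = A.st ↔ z = 0 ∧ t = 0 := by simpa using hline 0
  have he : p = A.ed ↔ z = 0 ∧ t = 1 := by simpa [← A.ed_eq] using hline 1
  have hi : Sbtw ℝ A.st p A.ed ↔ z = 0 ∧ 0 < t ∧ t < 1 := by
    rw [sbtw_iff_mem_image_Ioo_and_ne]
    constructor
    · rintro ⟨⟨r, hr, e⟩, -⟩
      obtain ⟨rfl, rfl⟩ := (hline r).1
        (by rw [← e, AffineMap.lineMap_apply_module']; simp [Dipole.dir, add_comm])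
      exact ⟨rfl, hr⟩
    · rintro ⟨hz, ht⟩
      refine ⟨⟨t, ht, ?_⟩, A.st_ne_ed⟩
      rw [(hline t).2 ⟨hz, rfl⟩, AffineMap.lineMap_apply_module']; simp [Dipole.dir, add_comm]
  have hf : Sbtw ℝ A.st A.ed p ↔ z = 0 ∧ 1 < t := by
    rw [sbtw_iff_left_ne_and_right_mem_image_Ioi]
    constructor
    · rintro ⟨-, ⟨r, hr, e⟩⟩
      obtain ⟨rfl, rfl⟩ := (hline r).1
        (by rw [← e, AffineMap.lineMap_apply_module']; simp [Dipole.dir, add_comm])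
      exact ⟨rfl, hr⟩
    · rintro ⟨hz, ht⟩
      refine ⟨A.st_ne_ed, ⟨t, ht, ?_⟩⟩
      rw [(hline t).2 ⟨hz, rfl⟩, AffineMap.lineMap_apply_module']; simp [Dipole.dir, add_comm]
  have hb : Sbtw ℝ p A.st A.ed ↔ z = 0 ∧ t < 0 := by
    have hl (r : ℝ) : AffineMap.lineMap A.ed A.st r = A.st + (1 - r) • A.dir := by
      rw [AffineMap.lineMap_apply_module']
      simp only [Dipole.dir]
      module
    rw [sbtw_iff_right_ne_and_left_mem_image_Ioi]
    constructor
    · rintro ⟨-, ⟨r, hr, e⟩⟩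
      obtain ⟨rfl, rfl⟩ := (hline (1 - r)).1 (by rw [← e, hl])
      exact ⟨rfl, by simpa using hr⟩
    · rintro ⟨hz, ht⟩
      refine ⟨A.st_ne_ed.symm, ⟨1 - t, Set.mem_Ioi.2 (by linarith), ?_⟩⟩
      rw [hl, (hline t).2 ⟨hz, rfl⟩]; simp
  have key : sign z * sign (det A.dir w) = sign (det A.dir (p - A.st)) := by
    rw [hdet, sign_mul]
  have hz : z = 0 ↔ sign (det A.dir (p - A.st)) = 0 := by simp [hdet, hw]
  rw [key]
  rw [hz] at hs he hi hf hb
  have ht₀ : t = 0 ↔ sign t = 0 := sign_eq_zero_iff.symm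
  have ht₁ : t = 1 ↔ sign (t - 1) = 0 := by rw [sign_eq_zero_iff, sub_eq_zero]
  have ht₂ : t < 1 ↔ sign (t - 1) = -1 := by rw [sign_eq_neg_one_iff, sub_neg]
  have ht₃ : 1 < t ↔ sign (t - 1) = 1 := by rw [sign_eq_one_iff, sub_pos]
  -- Only three signs remain; `hc` excludes the impossible pairs, and the equivalence is then a
  -- finite check.
  have hc := unitCompatible_sign t
  cases x <;> simp only [LR.Holds, hs, he, hi, hf, hb, ht₀, ht₁, ht₂, ht₃, ← sign_eq_one_iff,
    ← sign_eq_neg_one_iff] <;>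
    generalize sign (det A.dir (p - A.st)) = σ <;>
    generalize sign (t - 1) = τ₁ at hc ⊢ <;>
    generalize sign t = τ₀ at hc ⊢ <;>
    revert σ τ₀ τ₁ <;> decide

/-! ### Pairs of dipoles in the same relation -/

/-- The dipoles `A'`, `B'` stand in the same relation as `A`, `B`. -/
structure SameRel (A B A' B' : Dipole) : Prop where
  st_right : ∀ x : LR, x.Holds A B.st ↔ x.Holds A' B'.st
  ed_right : ∀ x : LR, x.Holds A B.ed ↔ x.Holds A' B'.ed
  st_left : ∀ x : LR, x.Holds B A.st ↔ x.Holds B' A'.st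
  ed_left : ∀ x : LR, x.Holds B A.ed ↔ x.Holds B' A'.ed
  sign_det : sign (det A.dir B.dir) = sign (det A'.dir B'.dir)
  sign_dot : det A.dir B.dir = 0 → sign (dot A.dir B.dir) = sign (dot A'.dir B'.dir)

theorem SameRel.symm {A B A' B' : Dipole} (h : SameRel A B A' B') : SameRel B A B' A' where
  st_right := h.st_left
  ed_right := h.ed_left
  st_left := h.st_right
  ed_left := h.ed_right
  sign_det := by
    rw [det_swap A.dir, det_swap A'.dir, Left.sign_neg, Left.sign_neg, h.sign_det]
  sign_dot h0 := by
    rw [dot_comm, dot_comm B'.dir]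
    exact h.sign_dot (by rw [det_swap, h0, neg_zero])

theorem QAngle.holds_congr {A B A' B' : Dipole} (q : QAngle)
    (h₁ : sign (det A.dir B.dir) = sign (det A'.dir B'.dir))
    (h₂ : det A.dir B.dir = 0 → sign (dot A.dir B.dir) = sign (dot A'.dir B'.dir)) :
    q.Holds A B → q.Holds A' B' := by
  cases q <;> simp only [QAngle.Holds, ← sign_eq_one_iff, ← sign_eq_neg_one_iff]
  · exact fun h => h₁ ▸ h
  · exact fun h => h₁ ▸ h
  all_goals
    rintro ⟨h, k⟩
    exact ⟨by rw [← sign_eq_zero_iff, ← h₁, h, sign_zero], h₂ h ▸ k⟩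

/-- `SameRel` also preserves the angle when the symbol does not record it, so it serves all symbols
uniformly. -/
theorem SameRel.mem_ext {A B A' B' : Dipole} (h : SameRel A B A' B') {x : RelSymbol}
    (hx : (A, B) ∈ x.ext) : (A', B') ∈ x.ext :=
  ⟨(h.st_right _).1 hx.1, (h.ed_right _).1 hx.2.1, (h.st_left _).1 hx.2.2.1,
    (h.ed_left _).1 hx.2.2.2.1,
    fun q hq => q.holds_congr h.sign_det h.sign_dot (hx.2.2.2.2 q hq)⟩

/-! ### Dipoles on crossing lines -/

/-- The lines of `A` and `B` meet in the point with parameter `t` along `A` and `s` along `B`. -/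
def Crosses (A B : Dipole) (t s : ℝ) : Prop := A.st + t • A.dir = B.st + s • B.dir

theorem exists_crosses {A B : Dipole} (h : det A.dir B.dir ≠ 0) : ∃ t s, Crosses A B t s := by
  refine ⟨det (B.st - A.st) B.dir / det A.dir B.dir, det (B.st - A.st) A.dir / det A.dir B.dir, ?_⟩
  ext
  all_goals
    simp only [Prod.fst_add, Prod.snd_add, Prod.smul_fst, Prod.smul_snd, smul_eq_mul]
    field_simp
    simp only [det, Prod.fst_sub, Prod.snd_sub]
    ring

namespace Crosses

variable {A B A' B' : Dipole} {t s t' s' : ℝ}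

theorem symm (h : Crosses A B t s) : Crosses B A s t := Eq.symm h

theorem holds_st (h : Crosses A B t s) (hD : det A.dir B.dir ≠ 0) (x : LR) :
    x.Holds A B.st ↔
      x = LR.ofSigns (-sign s * sign (det A.dir B.dir)) (sign t) (sign (t - 1)) := by
  rw [← Left.sign_neg]
  refine LR.holds_iff hD ?_ x
  rw [show A.st + t • A.dir = _ from h]
  module

theorem holds_ed (h : Crosses A B t s) (hD : det A.dir B.dir ≠ 0) (x : LR) :
    x.Holds A B.ed ↔
      x = LR.ofSigns (-sign (s - 1) * sign (det A.dir B.dir)) (sign t) (sign (t - 1)) := by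
  rw [← Left.sign_neg]
  refine LR.holds_iff hD ?_ x
  rw [show A.st + t • A.dir = _ from h, B.ed_eq]
  module

theorem det_swap_ne_zero {u v : Plane} (h : det u v ≠ 0) : det v u ≠ 0 := by
  rwa [det_swap, neg_ne_zero]

/-- With the direction of the other dipole as second axis, the end points of `B` have coordinates
`(t, -s)` and `(t, 1 - s)` relative to `A`, and symmetrically. So all four letters are functions of
the listed signs. -/
theorem sameRel (h : Crosses A B t s) (h' : Crosses A' B' t' s') (hD : det A.dir B.dir ≠ 0)
    (hDD : sign (det A.dir B.dir) = sign (det A'.dir B'.dir))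
    (ht₀ : sign t = sign t') (ht₁ : sign (t - 1) = sign (t' - 1))
    (hs₀ : sign s = sign s') (hs₁ : sign (s - 1) = sign (s' - 1)) : SameRel A B A' B' := by
  have hD' : det A'.dir B'.dir ≠ 0 := by
    rwa [← sign_ne_zero, ← hDD, sign_ne_zero]
  have hDD' : sign (det B.dir A.dir) = sign (det B'.dir A'.dir) := by
    rw [det_swap A.dir, det_swap A'.dir, Left.sign_neg, Left.sign_neg, hDD]
  refine ⟨fun x => ?_, fun x => ?_, fun x => ?_, fun x => ?_, hDD, fun h0 => absurd h0 hD⟩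
  · rw [h.holds_st hD, h'.holds_st hD', hDD, ht₀, ht₁, hs₀]
  · rw [h.holds_ed hD, h'.holds_ed hD', hDD, ht₀, ht₁, hs₁]
  · rw [h.symm.holds_st (det_swap_ne_zero hD), h'.symm.holds_st (det_swap_ne_zero hD'), hDD', hs₀,
      hs₁, ht₀]
  · rw [h.symm.holds_ed (det_swap_ne_zero hD), h'.symm.holds_ed (det_swap_ne_zero hD'), hDD', hs₀,
      hs₁, ht₁]

end Crosses

/-! ### Dipoles on parallel or equal lines -/

/-- In the affine frame with origin `A.st` and axes `A.dir`, `w`, the end points of `B` have the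
coordinates `(a, y)` and `(b, y)`. -/
structure ParallelAt (A B : Dipole) (w : Plane) (y a b : ℝ) : Prop where
  st_eq : B.st = A.st + a • A.dir + y • w
  ed_eq : B.ed = A.st + b • A.dir + y • w

theorem eq_add_smul_add_smul {u w : Plane} (hw : det u w ≠ 0) (p q : Plane) :
    p = q + (det (p - q) w / det u w) • u + (det u (p - q) / det u w) • w := by
  ext
  all_goals
    simp only [Prod.fst_add, Prod.snd_add, Prod.smul_fst, Prod.smul_snd, smul_eq_mul]
    field_simp
    simp only [det, Prod.fst_sub, Prod.snd_sub]
    ring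

theorem exists_parallelAt {A B : Dipole} {w : Plane} (hw : det A.dir w ≠ 0)
    (h : det A.dir B.dir = 0) : ∃ y a b, ParallelAt A B w y a b := by
  have h' : det A.dir (B.st - A.st) = det A.dir (B.ed - A.st) := by
    simp only [det, Dipole.dir, Prod.fst_sub, Prod.snd_sub] at h ⊢
    linear_combination -h
  exact ⟨det A.dir (B.st - A.st) / det A.dir w, _, _, eq_add_smul_add_smul hw _ _,
    by rw [h']; exact eq_add_smul_add_smul hw _ _⟩

namespace ParallelAt

variable {A B A' B' : Dipole} {w w' : Plane} {y a b y' a' b' : ℝ}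

theorem dir_eq (h : ParallelAt A B w y a b) : B.dir = (b - a) • A.dir := by
  rw [Dipole.dir, h.st_eq, h.ed_eq]
  module

theorem ne (h : ParallelAt A B w y a b) : b - a ≠ 0 := by
  intro h0
  exact B.dir_ne_zero (by rw [h.dir_eq, h0, zero_smul])

theorem det_dir (h : ParallelAt A B w y a b) (v : Plane) :
    det B.dir v = (b - a) * det A.dir v := by
  rw [h.dir_eq]
  simp only [det, Prod.smul_fst, Prod.smul_snd, smul_eq_mul]
  ring

theorem det_eq_zero (h : ParallelAt A B w y a b) : det A.dir B.dir = 0 := by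
  rw [h.dir_eq]
  simp only [det, Prod.smul_fst, Prod.smul_snd, smul_eq_mul]
  ring

theorem sign_dot_eq (h : ParallelAt A B w y a b) : sign (dot A.dir B.dir) = sign (b - a) := by
  have : dot A.dir B.dir = (b - a) * dot A.dir A.dir := by
    rw [h.dir_eq]
    simp only [dot, Prod.smul_fst, Prod.smul_snd, smul_eq_mul]
    ring
  rw [this, sign_mul, sign_pos (dot_self_pos A.dir_ne_zero), mul_one]

theorem holds_st (h : ParallelAt A B w y a b) (hw : det A.dir w ≠ 0) (x : LR) :
    x.Holds A B.st ↔ x = LR.ofSigns (sign y * sign (det A.dir w)) (sign a) (sign (a - 1)) :=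
  LR.holds_iff hw h.st_eq x

theorem holds_ed (h : ParallelAt A B w y a b) (hw : det A.dir w ≠ 0) (x : LR) :
    x.Holds A B.ed ↔ x = LR.ofSigns (sign y * sign (det A.dir w)) (sign b) (sign (b - 1)) :=
  LR.holds_iff hw h.ed_eq x

/-- Passing to the frame of `B` with the same `w` reverses the height and rescales the line by `b -
a`, which may be negative. -/
theorem symm (h : ParallelAt A B w y a b) :
    ParallelAt B A w (-y) (-(a / (b - a))) (-((a - 1) / (b - a))) := by
  have hab := h.ne
  constructor
  · rw [h.dir_eq, h.st_eq, smul_smul, neg_mul, div_mul_cancel₀ _ hab]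
    module
  · rw [h.dir_eq, h.st_eq, smul_smul, neg_mul, div_mul_cancel₀ _ hab, A.ed_eq]
    module

theorem det_ne_zero (h : ParallelAt A B w y a b) (hw : det A.dir w ≠ 0) : det B.dir w ≠ 0 := by
  rw [h.det_dir]
  exact mul_ne_zero h.ne hw

theorem holds_symm_st (h : ParallelAt A B w y a b) (hw : det A.dir w ≠ 0) (x : LR) :
    x.Holds B A.st ↔ x = LR.ofSigns (-(sign y * sign (det A.dir w)) * sign (b - a))
      (-(sign a * sign (b - a))) (-(sign b * sign (b - a))) := by
  have hab := h.ne
  rw [h.symm.holds_st (h.det_ne_zero hw), h.det_dir,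
    show -(a / (b - a)) - 1 = -(b / (b - a)) by field_simp; ring]
  simp only [Left.sign_neg, sign_mul, sign_div_eq_mul]
  rw [show -sign y * (sign (b - a) * sign (det A.dir w)) =
    -(sign y * sign (det A.dir w)) * sign (b - a) by
      generalize sign y = p; generalize sign (b - a) = q; generalize sign (det A.dir w) = r
      revert p q r; decide]

theorem holds_symm_ed (h : ParallelAt A B w y a b) (hw : det A.dir w ≠ 0) (x : LR) :
    x.Holds B A.ed ↔ x = LR.ofSigns (-(sign y * sign (det A.dir w)) * sign (b - a))
      (-(sign (a - 1) * sign (b - a))) (-(sign (b - 1) * sign (b - a))) := by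
  have hab := h.ne
  rw [h.symm.holds_ed (h.det_ne_zero hw), h.det_dir,
    show -((a - 1) / (b - a)) - 1 = -((b - 1) / (b - a)) by field_simp; ring]
  simp only [Left.sign_neg, sign_mul, sign_div_eq_mul]
  rw [show -sign y * (sign (b - a) * sign (det A.dir w)) =
    -(sign y * sign (det A.dir w)) * sign (b - a) by
      generalize sign y = p; generalize sign (b - a) = q; generalize sign (det A.dir w) = r
      revert p q r; decide]

/-- The position along the dipole matters only for points on its line. -/
theorem _root_.LR.ofSigns_congr {σ σ' a b a' b' : SignType} (hσ : σ = σ')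
    (h : σ = 0 → a = a' ∧ b = b') : LR.ofSigns σ a b = LR.ofSigns σ' a' b' := by
  revert σ σ' a b a' b'; decide +kernel

theorem sameRel (h : ParallelAt A B w y a b) (h' : ParallelAt A' B' w' y' a' b')
    (hw : det A.dir w ≠ 0) (hw' : det A'.dir w' ≠ 0)
    (hy : sign y * sign (det A.dir w) = sign y' * sign (det A'.dir w'))
    (hab : sign (b - a) = sign (b' - a'))
    (h0 : y = 0 → sign a = sign a' ∧ sign (a - 1) = sign (a' - 1) ∧
      sign b = sign b' ∧ sign (b - 1) = sign (b' - 1)) : SameRel A B A' B' := by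
  have h1 : sign y * sign (det A.dir w) = 0 → y = 0 := by simp [hw]
  have h2 : -(sign y * sign (det A.dir w)) * sign (b - a) = 0 → y = 0 := by
    rw [← sign_mul, ← Left.sign_neg, ← sign_mul, sign_eq_zero_iff]
    simp [hw, h.ne]
  refine ⟨fun x => ?_, fun x => ?_, fun x => ?_, fun x => ?_, ?_, ?_⟩
  · rw [h.holds_st hw, h'.holds_st hw', LR.ofSigns_congr hy]
    exact fun e => ⟨(h0 (h1 e)).1, (h0 (h1 e)).2.1⟩
  · rw [h.holds_ed hw, h'.holds_ed hw', LR.ofSigns_congr hy]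
    exact fun e => ⟨(h0 (h1 e)).2.2.1, (h0 (h1 e)).2.2.2⟩
  · rw [h.holds_symm_st hw, h'.holds_symm_st hw', LR.ofSigns_congr (by rw [hy, hab])]
    exact fun e => ⟨by rw [(h0 (h2 e)).1, hab], by rw [(h0 (h2 e)).2.2.1, hab]⟩
  · rw [h.holds_symm_ed hw, h'.holds_symm_ed hw', LR.ofSigns_congr (by rw [hy, hab])]
    exact fun e => ⟨by rw [(h0 (h2 e)).2.1, hab], by rw [(h0 (h2 e)).2.2.2, hab]⟩
  · rw [h.det_eq_zero, h'.det_eq_zero]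
  · rw [h.sign_dot_eq, h'.sign_dot_eq, hab]
    simp

end ParallelAt

/-! ### The base relations are jointly exhaustive -/

theorem crossing_word_mem_base {τ₀ τ₁ ρ₀ ρ₁ δ : SignType}
    (hτ : SignType.UnitCompatible τ₀ τ₁) (hρ : SignType.UnitCompatible ρ₀ ρ₁) (hδ : δ ≠ 0) :
    ⟨.ofSigns (-ρ₀ * δ) τ₀ τ₁, .ofSigns (-ρ₁ * δ) τ₀ τ₁,
        .ofSigns (-τ₀ * -δ) ρ₀ ρ₁, .ofSigns (-τ₁ * -δ) ρ₀ ρ₁,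
        some (if δ = 1 then .pos else .neg)⟩ ∈ baseSymbols ∨
      ⟨.ofSigns (-ρ₀ * δ) τ₀ τ₁, .ofSigns (-ρ₁ * δ) τ₀ τ₁,
        .ofSigns (-τ₀ * -δ) ρ₀ ρ₁, .ofSigns (-τ₁ * -δ) ρ₀ ρ₁, none⟩ ∈ baseSymbols := by
  revert τ₀ τ₁ ρ₀ ρ₁ δ; decide +kernel

set_option synthInstance.maxHeartbeats 200000 in
set_option synthInstance.maxSize 2000 in
-- Here `ε` stands for the sign of `b - a`; `h₁` and `h₂` discard sign patterns of `a`, `a - 1`,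
-- `b`, `b - 1` that contradict the order of `a` and `b`.
theorem parallel_word_mem_base {σ ε α₀ α₁ β₀ β₁ : SignType}
    (hα : SignType.UnitCompatible α₀ α₁) (hβ : SignType.UnitCompatible β₀ β₁) (hε : ε ≠ 0)
    (h₁ : ε = 1 → (α₀ ≠ -1 → β₀ = 1) ∧ (α₁ ≠ -1 → β₁ = 1))
    (h₂ : ε = -1 → (β₀ ≠ -1 → α₀ = 1) ∧ (β₁ ≠ -1 → α₁ = 1)) :
    ⟨.ofSigns σ α₀ α₁, .ofSigns σ β₀ β₁,
        .ofSigns (-σ * ε) (-(α₀ * ε)) (-(β₀ * ε)), .ofSigns (-σ * ε) (-(α₁ * ε)) (-(β₁ * ε)),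
        some (if ε = 1 then .par else .anti)⟩ ∈ baseSymbols ∨
      ⟨.ofSigns σ α₀ α₁, .ofSigns σ β₀ β₁,
        .ofSigns (-σ * ε) (-(α₀ * ε)) (-(β₀ * ε)), .ofSigns (-σ * ε) (-(α₁ * ε)) (-(β₁ * ε)),
        none⟩ ∈ baseSymbols := by
  revert σ ε α₀ α₁ β₀ β₁; decide +kernel

theorem exists_mem_ext (A B : Dipole) : ∃ z : DRAfp, (A, B) ∈ z.ext := by
  by_cases hD : det A.dir B.dir = 0
  · have hw : det A.dir (rot A.dir) ≠ 0 := by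
      rw [det_rot]
      exact (dot_self_pos A.dir_ne_zero).ne'
    obtain ⟨y, a, b, h⟩ := exists_parallelAt hw hD
    have hd := h.sign_dot_eq
    have hne : sign (b - a) ≠ 0 := sign_ne_zero.2 h.ne
    have hang : (if sign (b - a) = 1 then QAngle.par else QAngle.anti).Holds A B := by
      split_ifs with h1
      · exact ⟨hD, sign_eq_one_iff.1 (hd.trans h1)⟩
      · refine ⟨hD, sign_eq_neg_one_iff.1 (hd.trans ?_)⟩
        generalize sign (b - a) = e at hne h1
        revert e; decide
    rcases parallel_word_mem_base (σ := sign y * sign (det A.dir (rot A.dir)))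
      (unitCompatible_sign a) (unitCompatible_sign b) hne
      (fun e => by
        rw [sign_eq_one_iff] at e
        simp only [ne_eq, sign_eq_one_iff, sign_eq_neg_one_iff]
        constructor <;> intro <;> linarith)
      (fun e => by
        rw [sign_eq_neg_one_iff] at e
        simp only [ne_eq, sign_eq_one_iff, sign_eq_neg_one_iff]
        constructor <;> intro <;> linarith) with hz | hz
    · exact ⟨⟨_, hz⟩, (h.holds_st hw _).2 rfl, (h.holds_ed hw _).2 rfl,
        (h.holds_symm_st hw _).2 rfl, (h.holds_symm_ed hw _).2 rfl, by simpa using hang⟩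
    · exact ⟨⟨_, hz⟩, (h.holds_st hw _).2 rfl, (h.holds_ed hw _).2 rfl,
        (h.holds_symm_st hw _).2 rfl, (h.holds_symm_ed hw _).2 rfl, by simp⟩
  · obtain ⟨t, s, h⟩ := exists_crosses hD
    have hne := sign_ne_zero.2 hD
    have hang : (if sign (det A.dir B.dir) = 1 then QAngle.pos else QAngle.neg).Holds A B := by
      split_ifs with h1
      · exact sign_eq_one_iff.1 h1
      · refine sign_eq_neg_one_iff.1 ?_
        generalize sign (det A.dir B.dir) = e at hne h1
        revert e; decide
    have hs := h.symm.holds_st (Crosses.det_swap_ne_zero hD)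
    have he := h.symm.holds_ed (Crosses.det_swap_ne_zero hD)
    rw [det_swap A.dir, Left.sign_neg] at hs he
    rcases crossing_word_mem_base (unitCompatible_sign t) (unitCompatible_sign s) hne with hz | hz
    · exact ⟨⟨_, hz⟩, (h.holds_st hD _).2 rfl, (h.holds_ed hD _).2 rfl,
        (hs _).2 rfl, (he _).2 rfl, by simpa using hang⟩
    · exact ⟨⟨_, hz⟩, (h.holds_st hD _).2 rfl, (h.holds_ed hD _).2 rfl,
        (hs _).2 rfl, (he _).2 rfl, by simp⟩

/-! ### What a base relation determines -/

theorem LR.Holds.sign_det {x : LR} {A : Dipole} {p : Plane} (h : x.Holds A p) :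
    sign (det A.dir (p - A.st)) = x.side := by
  have hpos : 0 < det A.dir (rot A.dir) := by
    rw [det_rot]
    exact dot_self_pos A.dir_ne_zero
  rw [(LR.holds_iff hpos.ne' (eq_add_smul_add_smul hpos.ne' p A.st) x).1 h, LR.side_ofSigns,
    sign_div_eq_mul, sign_pos hpos, mul_one, mul_one]

theorem QAngle.Holds.sign_eq {q : QAngle} {A B A' B' : Dipole} (h : q.Holds A B)
    (h' : q.Holds A' B') : sign (det A.dir B.dir) = sign (det A'.dir B'.dir) ∧
      (det A.dir B.dir = 0 → sign (dot A.dir B.dir) = sign (dot A'.dir B'.dir)) := by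
  cases q <;> simp only [QAngle.Holds] at h h'
  · exact ⟨by rw [sign_pos h, sign_pos h'], fun e => absurd e h.ne'⟩
  · exact ⟨by rw [sign_neg h, sign_neg h'], fun e => absurd e h.ne⟩
  · exact ⟨by rw [h.1, h'.1], fun _ => by rw [sign_pos h.2, sign_pos h'.2]⟩
  · exact ⟨by rw [h.1, h'.1], fun _ => by rw [sign_neg h.2, sign_neg h'.2]⟩

/-- If each dipole has both end points of the other on one side, and `A` does so strictly, the
letters leave the angle open. This is where the refinement of the four words is used. -/
theorem angle_ne_none_of_side_eq {z : RelSymbol} (hz : z ∈ baseSymbols)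
    (h₁ : z.r₂.side = z.r₁.side) (h₂ : z.r₁.side ≠ 0) (h₃ : z.r₃.side = z.r₄.side) :
    z.angle ≠ none := by
  revert z; decide +kernel

/-- The determinant of the directions is a difference of two side determinants, seen from `A` or
from `C`. If either pair of sides differs, the letters decide its sign; otherwise the dipoles are
collinear or the symbol carries the angle. Collinear words carry none, hence the extra hypothesis
for the scalar product. -/
theorem sign_det_eq_of_mem_ext {z : DRAfp} {A C A' C' : Dipole} (h : (A, C) ∈ z.ext)
    (h' : (A', C') ∈ z.ext) : sign (det A.dir C.dir) = sign (det A'.dir C'.dir) ∧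
      (det A.dir C.dir = 0 → det A.dir (C.st - A.st) ≠ 0 →
        sign (dot A.dir C.dir) = sign (dot A'.dir C'.dir)) := by
  have e₁ (A C : Dipole) :
      det A.dir C.dir = det A.dir (C.ed - A.st) - det A.dir (C.st - A.st) := by
    simp only [det, Dipole.dir, Prod.fst_sub, Prod.snd_sub]; ring
  have e₂ (A C : Dipole) :
      det A.dir C.dir = det C.dir (A.st - C.st) - det C.dir (A.ed - C.st) := by
    simp only [det, Dipole.dir, Prod.fst_sub, Prod.snd_sub]; ring
  obtain ⟨h1, h2, h3, h4, hq⟩ := h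
  obtain ⟨h1', h2', h3', h4', hq'⟩ := h'
  have g1 := h1.sign_det
  have g1' := h1'.sign_det
  have g2 := h2.sign_det
  have g2' := h2'.sign_det
  have g3 := h3.sign_det
  have g3' := h3'.sign_det
  have g4 := h4.sign_det
  have g4' := h4'.sign_det
  by_cases k₁ : z.1.r₂.side = z.1.r₁.side
  swap
  · have : sign (det A.dir C.dir) = sign (det A'.dir C'.dir) := by
      rw [e₁, e₁]
      exact sign_sub_eq_of_sign_ne (g2.trans g2'.symm) (g1.trans g1'.symm) (by rwa [g1, g2])
    refine ⟨this, fun h0 => absurd ?_ k₁⟩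
    rw [e₁, sub_eq_zero] at h0
    rw [← g1, ← g2, h0]
  by_cases k₂ : z.1.r₃.side = z.1.r₄.side
  swap
  · have : sign (det A.dir C.dir) = sign (det A'.dir C'.dir) := by
      rw [e₂, e₂]
      exact sign_sub_eq_of_sign_ne (g3.trans g3'.symm) (g4.trans g4'.symm) (by rwa [g3, g4])
    refine ⟨this, fun h0 => absurd ?_ k₂⟩
    rw [e₂, sub_eq_zero] at h0
    rw [← g3, ← g4, h0]
  by_cases k₃ : z.1.r₁.side = 0
  · rw [k₁, k₃, sign_eq_zero_iff] at g2 g2'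
    rw [k₃, sign_eq_zero_iff] at g1 g1'
    exact ⟨by rw [e₁, e₁, g1, g2, g1', g2'], fun _ h0 => absurd g1 h0⟩
  · obtain ⟨q, e⟩ := Option.ne_none_iff_exists'.1 (angle_ne_none_of_side_eq z.2 k₁ k₃ k₂)
    obtain ⟨i, j⟩ := (hq q e).sign_eq (hq' q e)
    exact ⟨i, fun h0 _ => j h0⟩

theorem Crosses.sign_eq_of_mem_ext {z : DRAfp} {A C A' C' : Dipole} {t s t' s' : ℝ}
    (h : (A, C) ∈ z.ext) (h' : (A', C') ∈ z.ext) (hD : det A.dir C.dir ≠ 0)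
    (k : Crosses A C t s) (k' : Crosses A' C' t' s') :
    sign t = sign t' ∧ sign (t - 1) = sign (t' - 1) ∧
      sign s = sign s' ∧ sign (s - 1) = sign (s' - 1) := by
  have hDD := (sign_det_eq_of_mem_ext h h').1
  have hD' : det A'.dir C'.dir ≠ 0 := by rwa [← sign_ne_zero, ← hDD, sign_ne_zero]
  have hE := Crosses.det_swap_ne_zero hD
  have hE' := Crosses.det_swap_ne_zero hD'
  have hEE : sign (det C.dir A.dir) = sign (det C'.dir A'.dir) := by
    rw [det_swap A.dir, det_swap A'.dir, Left.sign_neg, Left.sign_neg, hDD]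
  obtain ⟨h1, h2, h3, h4, -⟩ := h
  obtain ⟨h1', h2', h3', h4', -⟩ := h'
  have g1 := congrArg LR.side (((k.holds_st hD _).1 h1).symm.trans ((k'.holds_st hD' _).1 h1'))
  have g2 := congrArg LR.side (((k.holds_ed hD _).1 h2).symm.trans ((k'.holds_ed hD' _).1 h2'))
  have g3 := congrArg LR.side
    (((k.symm.holds_st hE _).1 h3).symm.trans ((k'.symm.holds_st hE' _).1 h3'))
  have g4 := congrArg LR.side
    (((k.symm.holds_ed hE _).1 h4).symm.trans ((k'.symm.holds_ed hE' _).1 h4'))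
  rw [LR.side_ofSigns, LR.side_ofSigns] at g1 g2 g3 g4
  refine ⟨neg_injective ?_, neg_injective ?_, neg_injective ?_, neg_injective ?_⟩
  · exact SignType.eq_of_mul_eq_mul g3 hEE (sign_ne_zero.2 hE)
  · exact SignType.eq_of_mul_eq_mul g4 hEE (sign_ne_zero.2 hE)
  · exact SignType.eq_of_mul_eq_mul g1 hDD (sign_ne_zero.2 hD)
  · exact SignType.eq_of_mul_eq_mul g2 hDD (sign_ne_zero.2 hD)

theorem ParallelAt.sign_eq_of_mem_ext {z : DRAfp} {A C A' C' : Dipole} {w w' : Plane}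
    {y a b y' a' b' : ℝ} (h : (A, C) ∈ z.ext) (h' : (A', C') ∈ z.ext)
    (hw : 0 < det A.dir w) (hw' : 0 < det A'.dir w')
    (k : ParallelAt A C w y a b) (k' : ParallelAt A' C' w' y' a' b') :
    sign y = sign y' ∧ sign (b - a) = sign (b' - a') ∧
      (y = 0 → sign a = sign a' ∧ sign (a - 1) = sign (a' - 1) ∧
        sign b = sign b' ∧ sign (b - 1) = sign (b' - 1)) := by
  have hdet := (sign_det_eq_of_mem_ext h h').2 k.det_eq_zero
  obtain ⟨h1, h2, h3, h4, -⟩ := h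
  obtain ⟨h1', h2', h3', h4', -⟩ := h'
  have hside : sign (det A.dir (C.st - A.st)) = sign y := by
    rw [h1.sign_det, (k.holds_st hw.ne' _).1 h1, LR.side_ofSigns, sign_pos hw, mul_one]
  have f1 := ((k.holds_st hw.ne' _).1 h1).symm.trans ((k'.holds_st hw'.ne' _).1 h1')
  have f2 := ((k.holds_ed hw.ne' _).1 h2).symm.trans ((k'.holds_ed hw'.ne' _).1 h2')
  have f3 := ((k.symm.holds_st (k.det_ne_zero hw.ne') _).1 h3).symm.trans
    ((k'.symm.holds_st (k'.det_ne_zero hw'.ne') _).1 h3')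
  have f4 := ((k.symm.holds_ed (k.det_ne_zero hw.ne') _).1 h4).symm.trans
    ((k'.symm.holds_ed (k'.det_ne_zero hw'.ne') _).1 h4')
  rw [sign_pos hw, sign_pos hw', mul_one, mul_one] at f1 f2
  have hy : sign y = sign y' := by simpa only [LR.side_ofSigns] using congrArg LR.side f1
  by_cases h0 : y = 0
  · subst h0
    obtain rfl : y' = 0 := by rw [← sign_eq_zero_iff, ← hy, sign_zero]
    simp only [sign_zero, neg_zero, zero_mul] at f1 f2 f3 f4
    obtain ⟨a0, a1⟩ := LR.ofSigns_inj (unitCompatible_sign _) (unitCompatible_sign _) f1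
    obtain ⟨b0, b1⟩ := LR.ofSigns_inj (unitCompatible_sign _) (unitCompatible_sign _) f2
    have a2 := (LR.ofSigns_inj (unitCompatible_sign _) (unitCompatible_sign _) f3).1
    have a3 := (LR.ofSigns_inj (unitCompatible_sign _) (unitCompatible_sign _) f4).1
    simp only [Left.sign_neg, neg_inj, sign_div_eq_mul] at a2 a3
    refine ⟨rfl, ?_, fun _ => ⟨a0, a1, b0, b1⟩⟩
    -- The orientation is read off from a quotient by `b - a` with nonzero numerator: `a` or, when
    -- `a = 0`, `a - 1`.
    by_cases ha : a = 0
    · rw [mul_comm, mul_comm (sign (a' - 1))] at a3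
      exact SignType.eq_of_mul_eq_mul a3 a1 (by simp [ha])
    · rw [mul_comm, mul_comm (sign a')] at a2
      exact SignType.eq_of_mul_eq_mul a2 a0 (sign_ne_zero.2 ha)
  · have hd := hdet (by rwa [← sign_ne_zero, hside, sign_ne_zero])
    rw [k.sign_dot_eq, k'.sign_dot_eq] at hd
    exact ⟨hy, hd, fun e => absurd e h0⟩

/-! ### Transfer of the middle dipole -/

theorem exists_dipole_through {p q : Plane} (hpq : q - p ≠ 0) {s r : ℝ} (hrs : r - s ≠ 0) :
    ∃ B : Dipole, B.st + s • B.dir = p ∧ B.st + r • B.dir = q ∧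
      B.dir = (r - s)⁻¹ • (q - p) := by
  refine ⟨⟨p - (s * (r - s)⁻¹) • (q - p), p - (s * (r - s)⁻¹) • (q - p) + (r - s)⁻¹ • (q - p),
    ?_⟩, ?_⟩
  · intro e
    rw [left_eq_add] at e
    exact (smul_ne_zero (inv_ne_zero hrs) hpq) e
  · simp only [Dipole.dir, add_sub_cancel_left, smul_smul]
    refine ⟨by module, ?_, trivial⟩
    have : r * (r - s)⁻¹ = 1 + s * (r - s)⁻¹ := by field_simp; ring
    rw [this]
    module

theorem exists_dipole_dir (p : Plane) {v : Plane} (hv : v ≠ 0) (s : ℝ) :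
    ∃ B : Dipole, B.st + s • B.dir = p ∧ B.dir = v := by
  refine ⟨⟨p - s • v, p - s • v + v, fun e => hv (left_eq_add.1 e)⟩, ?_⟩
  simp [Dipole.dir]

theorem exists_parallel_dipole (A : Dipole) (w : Plane) (y : ℝ) {a b : ℝ} (hab : b - a ≠ 0) :
    ∃ B : Dipole, ParallelAt A B w y a b := by
  refine ⟨⟨A.st + a • A.dir + y • w, A.st + b • A.dir + y • w, fun e => ?_⟩, rfl, rfl⟩
  have : (b - a) • A.dir = 0 := by
    rw [sub_smul, sub_eq_zero]
    exact (add_left_cancel (add_right_cancel e)).symm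
  exact smul_ne_zero hab A.dir_ne_zero this

theorem SameOrder.exists_cons_zero_one {a a' : ℝ} (h₀ : sign a = sign a')
    (h₁ : sign (a - 1) = sign (a' - 1)) (x : ℝ) :
    ∃ x', sign x = sign x' ∧ sign (x - 1) = sign (x' - 1) ∧ sign (x - a) = sign (x' - a') := by
  obtain ⟨x', h⟩ := (sameOrder_zero_one_cons h₀ h₁).exists_cons x
  exact ⟨x', by simpa using h 0 2, h 0 3, h 0 1⟩

theorem det_zero_right (u : Plane) : det u 0 = 0 := by simp [det]

theorem det_smul_right (u v : Plane) (x : ℝ) : det u (x • v) = x * det u v := by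
  simp only [det, Prod.smul_fst, Prod.smul_snd, smul_eq_mul]; ring

theorem det_smul_left (u v : Plane) (x : ℝ) : det (x • u) v = x * det u v := by
  simp only [det, Prod.smul_fst, Prod.smul_snd, smul_eq_mul]; ring

theorem det_add_smul (u v : Plane) (x y : ℝ) : det u (x • u + y • v) = y * det u v := by
  simp only [det, Prod.fst_add, Prod.snd_add, Prod.smul_fst, Prod.smul_snd, smul_eq_mul]; ring

theorem det_smul_add (u v : Plane) (x y : ℝ) : det (x • u + y • v) v = x * det u v := by
  simp only [det, Prod.fst_add, Prod.snd_add, Prod.smul_fst, Prod.smul_snd, smul_eq_mul]; ring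

/-- The middle dipole `B` between `A` and `C` has a counterpart between `A'` and `C'`. -/
def Transfers (A B C A' C' : Dipole) : Prop :=
  ∃ B', SameRel A B A' B' ∧ SameRel B C B' C'

theorem Transfers.symm {A B C A' C' : Dipole} (h : Transfers A B C A' C') :
    Transfers C B A C' A' := by
  obtain ⟨B', h₁, h₂⟩ := h
  exact ⟨B', h₂.symm, h₁.symm⟩

/-! ### Transfer when the lines of `A` and `C` cross -/

section Crossing

variable {A B C A' C' : Dipole} {α γ α' γ' : ℝ}

theorem transfers_of_crosses_of_parallel (k : Crosses A C α γ) (k' : Crosses A' C' α' γ')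
    (hD : det A.dir C.dir ≠ 0) (hDD : sign (det A.dir C.dir) = sign (det A'.dir C'.dir))
    (hα₀ : sign α = sign α') (hα₁ : sign (α - 1) = sign (α' - 1))
    (hγ₀ : sign γ = sign γ') (hγ₁ : sign (γ - 1) = sign (γ' - 1))
    (hB : det A.dir B.dir = 0) : Transfers A B C A' C' := by
  have hD' : det A'.dir C'.dir ≠ 0 := by rwa [← sign_ne_zero, ← hDD, sign_ne_zero]
  obtain ⟨y, a, b, p⟩ := exists_parallelAt hD hB
  -- In the axes `A.dir`, `C.dir`, the line of `B` at height `y` meets the line of `C` at parameter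
  -- `γ + y`. Along `A`, the numbers `a`, `b` must keep their order relative to `0`, `1` and the
  -- crossing parameter `α`.
  obtain ⟨c', hc₀, hc₁, hc₂⟩ := SameOrder.exists_cons_zero_one hγ₀ hγ₁ (γ + y)
  obtain ⟨a', ha⟩ := (sameOrder_zero_one_cons hα₀ hα₁).exists_cons a
  obtain ⟨b', hb⟩ := ha.exists_cons b
  have hab : sign (b - a) = sign (b' - a') := hb 0 1
  have hb0 : sign b = sign b' := by simpa using hb 0 3
  have ha0 : sign a = sign a' := by simpa using ha 0 2
  have hb1 : sign (b - 1) = sign (b' - 1) := hb 0 4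
  have ha1 : sign (a - 1) = sign (a' - 1) := ha 0 3
  have haα : sign (α - a) = sign (α' - a') := ha 1 0
  have hbα : sign (α - b) = sign (α' - b') := hb 2 0
  have hba' : b' - a' ≠ 0 := by rw [← sign_ne_zero, ← hab, sign_ne_zero]; exact p.ne
  obtain ⟨B', p'⟩ := exists_parallel_dipole A' C'.dir (c' - γ') hba'
  have crossBC {A B C : Dipole} {α γ y a b : ℝ} (k : Crosses A C α γ)
      (p : ParallelAt A B C.dir y a b) : Crosses B C ((α - a) / (b - a)) (γ + y) := by
    rw [Crosses, p.dir_eq, smul_smul, div_mul_cancel₀ _ p.ne, p.st_eq, add_smul, ← add_assoc,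
      ← show A.st + α • A.dir = _ from k]
    module
  have param {α a b : ℝ} (h : b - a ≠ 0) : (α - a) / (b - a) - 1 = (α - b) / (b - a) := by
    field_simp; ring
  refine ⟨B', p.sameRel p' hD hD' ?_ hab fun _ => ⟨ha0, ha1, hb0, hb1⟩,
    (crossBC k p).sameRel (crossBC k' p') (p.det_ne_zero hD) ?_ ?_ ?_ ?_ ?_⟩
  · rw [← hc₂, hDD, add_sub_cancel_left]
  · rw [p.det_dir, p'.det_dir, sign_mul, sign_mul, hab, hDD]
  · rw [sign_div_eq_mul, sign_div_eq_mul, haα, hab]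
  · rw [param p.ne, param hba', sign_div_eq_mul, sign_div_eq_mul, hbα, hab]
  · rw [hc₀, add_sub_cancel]
  · rw [hc₁, add_sub_cancel]

theorem transfers_of_crosses (k : Crosses A C α γ) (k' : Crosses A' C' α' γ')
    (hD : det A.dir C.dir ≠ 0) (hDD : sign (det A.dir C.dir) = sign (det A'.dir C'.dir))
    (hα₀ : sign α = sign α') (hα₁ : sign (α - 1) = sign (α' - 1))
    (hγ₀ : sign γ = sign γ') (hγ₁ : sign (γ - 1) = sign (γ' - 1)) :
    Transfers A B C A' C' := by
  have hD' : det A'.dir C'.dir ≠ 0 := by rwa [← sign_ne_zero, ← hDD, sign_ne_zero]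
  by_cases hAB : det A.dir B.dir = 0
  · exact transfers_of_crosses_of_parallel k k' hD hDD hα₀ hα₁ hγ₀ hγ₁ hAB
  by_cases hCB : det C.dir B.dir = 0
  · refine (transfers_of_crosses_of_parallel k.symm k'.symm (Crosses.det_swap_ne_zero hD) ?_
      hγ₀ hγ₁ hα₀ hα₁ hCB).symm
    rw [det_swap A.dir, det_swap A'.dir, Left.sign_neg, Left.sign_neg, hDD]
  have hBC := Crosses.det_swap_ne_zero hCB
  obtain ⟨t, s, h⟩ := exists_crosses hAB
  obtain ⟨r, c, l⟩ := exists_crosses hBC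
  obtain ⟨t', ht₀, ht₁, ht₂⟩ := SameOrder.exists_cons_zero_one hα₀ hα₁ t
  obtain ⟨c', hc₀, hc₁, hc₂⟩ := SameOrder.exists_cons_zero_one hγ₀ hγ₁ c
  have diff {A C : Dipole} {α γ t c : ℝ} (k : Crosses A C α γ) :
      C.st + c • C.dir - (A.st + t • A.dir) = (α - t) • A.dir + (c - γ) • C.dir := by
    have : C.st = A.st + α • A.dir - γ • C.dir := by
      rw [show A.st + α • A.dir = _ from k]; module
    rw [this]; module
  have hdir : (r - s) • B.dir = (α - t) • A.dir + (c - γ) • C.dir := by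
    rw [← diff k, ← show B.st + r • B.dir = _ from l, show A.st + t • A.dir = _ from h]; module
  -- These two identities reduce both angles of `B` to the order of `c, γ` and of `t, α`, which the
  -- transfer preserves.
  have e₁ : (r - s) * det A.dir B.dir = (c - γ) * det A.dir C.dir := by
    rw [← det_smul_right, hdir, det_add_smul]
  have e₂ : (r - s) * det B.dir C.dir = (α - t) * det A.dir C.dir := by
    rw [← det_smul_left, hdir, det_smul_add]
  by_cases hrs : r - s = 0
  · -- `B` passes through the common point of the lines of `A` and `C`
    have hcγ : c - γ = 0 := by simpa [hrs, hD] using e₁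
    have htα : t - α = 0 := by
      have : α - t = 0 := by simpa [hrs, hD] using e₂
      linarith
    rw [hcγ, sign_zero, eq_comm, sign_eq_zero_iff, sub_eq_zero] at hc₂
    rw [htα, sign_zero, eq_comm, sign_eq_zero_iff, sub_eq_zero] at ht₂
    obtain rfl := sub_eq_zero.1 hrs
    subst hc₂ ht₂
    -- By Cramer's rule `x`, `y` are the coordinates of `B.dir` in the basis `A.dir`, `C.dir`; `B'`
    -- gets the same coordinates in the primed basis.
    set x := det B.dir C.dir / det A.dir C.dir with hx
    set y := det A.dir B.dir / det A.dir C.dir with hy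
    have hx' : sign (det B.dir C.dir) = sign (x * det A'.dir C'.dir) := by
      rw [sign_mul, ← hDD, ← sign_mul, hx, div_mul_cancel₀ _ hD]
    have hy' : sign (det A.dir B.dir) = sign (y * det A'.dir C'.dir) := by
      rw [sign_mul, ← hDD, ← sign_mul, hy, div_mul_cancel₀ _ hD]
    have hv : x • A'.dir + y • C'.dir ≠ 0 := by
      intro e
      rw [← det_add_smul A'.dir C'.dir x y, e, det_zero_right, sign_zero, sign_eq_zero_iff] at hy'
      exact hAB hy'
    obtain ⟨B', hB', hd⟩ := exists_dipole_dir (A'.st + t' • A'.dir) hv r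
    refine ⟨B', h.sameRel hB'.symm hAB ?_ ht₀ ht₁ rfl rfl,
      l.sameRel (hB'.trans k') hBC ?_ rfl rfl hc₀ hc₁⟩
    · rw [hd, det_add_smul, hy']
    · rw [hd, det_smul_add, hx']
  · have hc : sign (det A.dir B.dir) * sign (r - s) = sign (c' - γ') * sign (det A'.dir C'.dir) := by
      rw [← sign_mul, mul_comm, e₁, sign_mul, hc₂, hDD]
    have ht : sign (det B.dir C.dir) * sign (r - s) = sign (α' - t') * sign (det A'.dir C'.dir) := by
      rw [← sign_mul, mul_comm, e₂, sign_mul, sign_sub_comm, ht₂, hDD, ← sign_sub_comm]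
    have hpq : C'.st + c' • C'.dir - (A'.st + t' • A'.dir) ≠ 0 := by
      rw [diff k']
      intro e
      have := det_add_smul A'.dir C'.dir (α' - t') (c' - γ')
      rw [e, det_zero_right, eq_comm, mul_eq_zero] at this
      have h0 : c' - γ' = 0 := this.resolve_right hD'
      rw [h0, sign_zero, zero_mul, ← sign_mul, sign_eq_zero_iff] at hc
      exact mul_ne_zero hAB hrs hc
    -- The parameters `s` and `r` along the middle dipole are kept; only the two points it passes
    -- through move.
    obtain ⟨B', hB₁, hB₂, hd⟩ := exists_dipole_through hpq hrs
    have hd' : (r - s) • B'.dir = (α' - t') • A'.dir + (c' - γ') • C'.dir := by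
      rw [hd, smul_smul, mul_inv_cancel₀ hrs, one_smul, diff k']
    have e₁' : (r - s) * det A'.dir B'.dir = (c' - γ') * det A'.dir C'.dir := by
      rw [← det_smul_right, hd', det_add_smul]
    have e₂' : (r - s) * det B'.dir C'.dir = (α' - t') * det A'.dir C'.dir := by
      rw [← det_smul_left, hd', det_smul_add]
    refine ⟨B', h.sameRel hB₁.symm hAB ?_ ht₀ ht₁ rfl rfl, l.sameRel hB₂ hBC ?_ rfl rfl hc₀ hc₁⟩
    · refine SignType.eq_of_mul_eq_mul ?_ rfl (sign_ne_zero.2 hrs)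
      rw [hc, ← sign_mul, ← e₁', ← sign_mul, mul_comm]
    · refine SignType.eq_of_mul_eq_mul ?_ rfl (sign_ne_zero.2 hrs)
      rw [ht, ← sign_mul, ← e₂', ← sign_mul, mul_comm]

end Crossing

/-! ### Transfer when the lines of `A` and `C` are parallel or equal -/

section Parallel

variable {A B C A' C' : Dipole} {w w' : Plane} {h c d h' c' d' : ℝ}

theorem ParallelAt.trans_symm {k a b : ℝ} (q : ParallelAt A B w k a b)
    (p : ParallelAt A C w h c d) :
    ParallelAt C B w (k - h) ((a - c) / (d - c)) ((b - c) / (d - c)) := by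
  constructor
  · rw [p.dir_eq, smul_smul, div_mul_cancel₀ _ p.ne, q.st_eq, p.st_eq]; module
  · rw [p.dir_eq, smul_smul, div_mul_cancel₀ _ p.ne, q.ed_eq, p.st_eq]; module

theorem transfers_of_parallelAt_of_parallel (p : ParallelAt A C w h c d)
    (p' : ParallelAt A' C' w' h' c' d') (hw : 0 < det A.dir w) (hw' : 0 < det A'.dir w')
    (hh : sign h = sign h') (hcd : sign (d - c) = sign (d' - c'))
    (h0 : h = 0 → sign c = sign c' ∧ sign (c - 1) = sign (c' - 1) ∧
      sign d = sign d' ∧ sign (d - 1) = sign (d' - 1))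
    (hB : det A.dir B.dir = 0) : Transfers A B C A' C' := by
  obtain ⟨k, a, b, q⟩ := exists_parallelAt hw.ne' hB
  obtain ⟨k', hk⟩ := (sameOrder_pair (a := h) (b := 0) (a' := h') (b' := 0)
    (by simpa using hh)).exists_cons k
  have hk0 : sign k = sign k' := by simpa using hk 0 2
  have hkh : sign (k - h) = sign (k' - h') := hk 0 1
  have hdcd : sign (c - d) = sign (c' - d') := by
    rw [sign_sub_comm, hcd, ← sign_sub_comm]
  -- Positions along the line of `B` matter relative to `A` only at height `0`, relative to `C` only
  -- at height `h`. Both constraints apply together only if `h = 0`, where the order of `c, d, 0, 1`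
  -- is known to agree.
  obtain ⟨a', b', hab, hA, hC⟩ : ∃ a' b', sign (b - a) = sign (b' - a') ∧
      (k = 0 → sign a = sign a' ∧ sign (a - 1) = sign (a' - 1) ∧
        sign b = sign b' ∧ sign (b - 1) = sign (b' - 1)) ∧
      (k = h → sign (a - c) = sign (a' - c') ∧ sign (a - d) = sign (a' - d') ∧
        sign (b - c) = sign (b' - c') ∧ sign (b - d) = sign (b' - d')) := by
    by_cases hz : h = 0
    · obtain ⟨c0, c1, d0, d1⟩ := h0 hz
      obtain ⟨a', ha⟩ := (sameOrder_zero_one_pair hcd c0 c1 d0 d1).exists_cons a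
      obtain ⟨b', hb⟩ := ha.exists_cons b
      exact ⟨a', b', hb 0 1,
        fun _ => ⟨by simpa using ha 0 3, ha 0 4, by simpa using hb 0 4, hb 0 5⟩,
        fun _ => ⟨ha 0 1, ha 0 2, hb 0 2, hb 0 3⟩⟩
    by_cases hkh : k = h
    · obtain ⟨a', ha⟩ := (sameOrder_pair hdcd).exists_cons a
      obtain ⟨b', hb⟩ := ha.exists_cons b
      exact ⟨a', b', hb 0 1, fun e => absurd (hkh.symm.trans e) hz,
        fun _ => ⟨ha 0 1, ha 0 2, hb 0 2, hb 0 3⟩⟩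
    · exact ⟨a, b, rfl, fun _ => ⟨rfl, rfl, rfl, rfl⟩, fun e => absurd e hkh⟩
  obtain ⟨B', q'⟩ := exists_parallel_dipole A' w' k' (a := a') (b := b')
    (by rw [← sign_ne_zero, ← hab, sign_ne_zero]; exact q.ne)
  have param {x c d : ℝ} (h : d - c ≠ 0) : (x - c) / (d - c) - 1 = (x - d) / (d - c) := by
    field_simp; ring
  have sub {x y c d : ℝ} : (y - c) / (d - c) - (x - c) / (d - c) = (y - x) / (d - c) := by
    ring
  refine ⟨B', q.sameRel q' hw.ne' hw'.ne' (by rw [hk0, sign_pos hw, sign_pos hw']) hab hA,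
    ((q.trans_symm p).sameRel (q'.trans_symm p') (p.det_ne_zero hw.ne') (p'.det_ne_zero hw'.ne')
      ?_ ?_ ?_).symm⟩
  · rw [p.det_dir, p'.det_dir, sign_mul, sign_mul, hkh, hcd, sign_pos hw, sign_pos hw']
  · rw [sub, sub, sign_div_eq_mul, sign_div_eq_mul, hab, hcd]
  · intro e
    obtain ⟨h1, h2, h3, h4⟩ := hC (sub_eq_zero.1 e)
    simp only [param p.ne, param p'.ne, sign_div_eq_mul, h1, h2, h3, h4, hcd, and_self]

theorem transfers_of_parallelAt (p : ParallelAt A C w h c d)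
    (p' : ParallelAt A' C' w' h' c' d') (hw : 0 < det A.dir w) (hw' : 0 < det A'.dir w')
    (hh : sign h = sign h') (hcd : sign (d - c) = sign (d' - c'))
    (h0 : h = 0 → sign c = sign c' ∧ sign (c - 1) = sign (c' - 1) ∧
      sign d = sign d' ∧ sign (d - 1) = sign (d' - 1)) : Transfers A B C A' C' := by
  by_cases hAB : det A.dir B.dir = 0
  · exact transfers_of_parallelAt_of_parallel p p' hw hw' hh hcd h0 hAB
  have hBC : det B.dir C.dir ≠ 0 := by
    rw [det_swap, p.det_dir]
    exact neg_ne_zero.2 (mul_ne_zero p.ne hAB)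
  have sign_BC {A B C : Dipole} {w : Plane} {h c d : ℝ} (p : ParallelAt A C w h c d) :
      sign (det B.dir C.dir) = -(sign (d - c) * sign (det A.dir B.dir)) := by
    rw [det_swap, p.det_dir, Left.sign_neg, sign_mul]
  obtain ⟨t, s, k⟩ := exists_crosses hAB
  by_cases hz : h = 0
  · -- `A` and `C` lie on the same line
    subst hz
    obtain rfl : h' = 0 := by rw [← sign_eq_zero_iff, ← hh, sign_zero]
    obtain ⟨c0, c1, d0, d1⟩ := h0 rfl
    obtain ⟨t', ht⟩ := (sameOrder_zero_one_pair hcd c0 c1 d0 d1).exists_cons t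
    have t0 : sign t = sign t' := by simpa using ht 0 3
    have t1 : sign (t - 1) = sign (t' - 1) := ht 0 4
    have tc : sign (t - c) = sign (t' - c') := ht 0 1
    have td : sign (t - d) = sign (t' - d') := ht 0 2
    have hv : det A'.dir (det A.dir B.dir • w') ≠ 0 := by
      rw [det_smul_right]
      exact mul_ne_zero hAB hw'.ne'
    -- Any direction on the correct side of `A'` would do; the factor `det A.dir B.dir` supplies the
    -- sign.
    obtain ⟨B', hB', hd⟩ := exists_dipole_dir (A'.st + t' • A'.dir)
      (v := det A.dir B.dir • w') (by rintro e; rw [e, det_zero_right] at hv; exact hv rfl) s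
    have hDD : sign (det A.dir B.dir) = sign (det A'.dir B'.dir) := by
      rw [hd, det_smul_right, sign_mul, sign_pos hw', mul_one]
    have cross {A B C : Dipole} {w : Plane} {c d t : ℝ} (p : ParallelAt A C w 0 c d)
        (k : B.st + s • B.dir = A.st + t • A.dir) : Crosses B C s ((t - c) / (d - c)) := by
      rw [Crosses, k, p.dir_eq, smul_smul, div_mul_cancel₀ _ p.ne, p.st_eq]
      module
    have param {x c d : ℝ} (h : d - c ≠ 0) : (x - c) / (d - c) - 1 = (x - d) / (d - c) := by
      field_simp; ring
    refine ⟨B', k.sameRel hB'.symm hAB hDD t0 t1 rfl rfl,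
      (cross p k.symm).sameRel (cross p' hB') hBC ?_ rfl rfl ?_ ?_⟩
    · rw [sign_BC p, sign_BC p', hDD, hcd]
    · rw [sign_div_eq_mul, sign_div_eq_mul, tc, hcd]
    · rw [param p.ne, param p'.ne, sign_div_eq_mul, sign_div_eq_mul, td, hcd]
  · -- the lines of `A` and `C` are parallel and distinct
    have hz' : h' ≠ 0 := by rwa [← sign_ne_zero, ← hh, sign_ne_zero]
    obtain ⟨r, e, l⟩ := exists_crosses hBC
    have diff {A C : Dipole} {w : Plane} {h c d : ℝ} (p : ParallelAt A C w h c d) :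
        C.st + e • C.dir - (A.st + t • A.dir) = (c + e * (d - c) - t) • A.dir + h • w := by
      rw [p.dir_eq, p.st_eq]; module
    have hdir : (r - s) • B.dir = (c + e * (d - c) - t) • A.dir + h • w := by
      rw [← diff p, ← show B.st + r • B.dir = _ from l, show A.st + t • A.dir = _ from k]; module
    have e₁ : (r - s) * det A.dir B.dir = h * det A.dir w := by
      rw [← det_smul_right, hdir, det_add_smul]
    have hrs : r - s ≠ 0 := by
      intro e0
      rw [e0, zero_mul, eq_comm] at e₁
      exact mul_ne_zero hz hw.ne' e₁
    -- Points on two distinct parallel lines can be chosen independently, so `t` and `e` are reused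
    -- unchanged.
    have hpq : C'.st + e • C'.dir - (A'.st + t • A'.dir) ≠ 0 := by
      rw [diff p']
      intro e0
      have := det_add_smul A'.dir w' (c' + e * (d' - c') - t) h'
      rw [e0, det_zero_right, eq_comm] at this
      exact mul_ne_zero hz' hw'.ne' this
    obtain ⟨B', hB₁, hB₂, hd⟩ := exists_dipole_through hpq hrs
    have e₁' : (r - s) * det A'.dir B'.dir = h' * det A'.dir w' := by
      rw [← det_smul_right, hd, smul_smul, mul_inv_cancel₀ hrs, one_smul, diff p', det_add_smul]
    have hDD : sign (det A.dir B.dir) = sign (det A'.dir B'.dir) := by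
      refine SignType.eq_of_mul_eq_mul ?_ rfl (sign_ne_zero.2 hrs)
      rw [← sign_mul, mul_comm, e₁, ← sign_mul, mul_comm (det A'.dir B'.dir), e₁', sign_mul,
        sign_mul, hh, sign_pos hw, sign_pos hw']
    refine ⟨B', k.sameRel hB₁.symm hAB hDD rfl rfl rfl rfl,
      l.sameRel hB₂ hBC ?_ rfl rfl rfl rfl⟩
    rw [sign_BC p, sign_BC p', hDD, hcd]

end Parallel

/-! ### Strength of the composition -/

theorem transfers_of_mem_ext {z : DRAfp} {A C A' C' : Dipole} (h : (A, C) ∈ z.ext)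
    (h' : (A', C') ∈ z.ext) (B : Dipole) : Transfers A B C A' C' := by
  have hDD := (sign_det_eq_of_mem_ext h h').1
  by_cases hD : det A.dir C.dir = 0
  · have hD' : det A'.dir C'.dir = 0 := by rw [← sign_eq_zero_iff, ← hDD, hD, sign_zero]
    have hw (A : Dipole) : 0 < det A.dir (rot A.dir) := by
      rw [det_rot]
      exact dot_self_pos A.dir_ne_zero
    obtain ⟨y, a, b, p⟩ := exists_parallelAt (hw A).ne' hD
    obtain ⟨y', a', b', p'⟩ := exists_parallelAt (hw A').ne' hD'
    obtain ⟨hy, hab, h0⟩ := p.sign_eq_of_mem_ext h h' (hw A) (hw A') p'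
    exact transfers_of_parallelAt p p' (hw A) (hw A') hy hab h0
  · have hD' : det A'.dir C'.dir ≠ 0 := by rwa [← sign_ne_zero, ← hDD, sign_ne_zero]
    obtain ⟨t, s, k⟩ := exists_crosses hD
    obtain ⟨t', s', k'⟩ := exists_crosses hD'
    obtain ⟨ht₀, ht₁, hs₀, hs₁⟩ := k.sign_eq_of_mem_ext h h' hD k'
    exact transfers_of_crosses k k' hD hDD ht₀ ht₁ hs₀ hs₁

theorem exists_middle_of_mem_weakComp {x y z : DRAfp} (hz : z ∈ DRAfp.weakComp x y)
    {A C : Dipole} (h : (A, C) ∈ z.ext) : ∃ B : Dipole, (A, B) ∈ x.ext ∧ (B, C) ∈ y.ext := by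
  obtain ⟨⟨A₀, C₀⟩, ⟨B₀, hx, hy⟩, h₀⟩ := hz
  obtain ⟨B, h₁, h₂⟩ := transfers_of_mem_ext h₀ h B₀
  exact ⟨B, h₁.mem_ext hx, h₂.mem_ext hy⟩

theorem mainTheorem1 (rab rbc : DRAfp) :
    DRAfp.extSet (DRAfp.weakComp rab rbc) = SetRel.comp rab.ext rbc.ext ∧
      ∀ rac ∈ DRAfp.weakComp rab rbc, ∀ A C : Dipole, (A, C) ∈ rac.ext →
        ∃ B : Dipole, (A, B) ∈ rab.ext ∧ (B, C) ∈ rbc.ext := by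
  refine ⟨Set.ext fun ⟨A, C⟩ => ?_, fun rac hz A C h => exists_middle_of_mem_weakComp hz h⟩
  simp only [DRAfp.extSet, Set.mem_iUnion]
  constructor
  · rintro ⟨z, hz, h⟩
    exact exists_middle_of_mem_weakComp hz h
  · intro h
    -- The pair `(A, C)` itself witnesses that its base relation belongs to the weak composition.
    obtain ⟨z, hz⟩ := exists_mem_ext A C
    exact ⟨z, ⟨(A, C), h, hz⟩, hz⟩
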